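/- Let $V$ be a separable right quaternionic Hilbert space, let $\mathcal B(V)$ be the algebra of bounded right $\mathbb H$-linear operators on $V$, $\mathcal K(V)$ its closed two-sided ideal of compact operators, and $\pi:\mathcal B(V)\to\mathcal B(V)/\mathcal K(V)$ the quotient map. An operator $A\in\mathcal B(V)$ is called Fredholm if $\pi(A)$ is invertible. For $A\in\mathcal B(V)$ with $\ker A$ and $\ker A^*$ finite-dimensional put $$\operatorname{ind}(A)=\dim_{\mathbb H}\ker A-\dim_{\mathbb H}\ker A^*.$$ For $T\in\mathcal B(V)$ and $q\in\mathbb H$ let $R_q(T)=T^2-2\operatorname{Re}(q)\,T+|q|^2 I$, and let $$\Phi_{T,\pi}=\{q\in\mathbb H:\ R_q(T)\ \text{is Fredholm}\}.$$ Then for every $T\in\mathcal B(V)$: for each $q\in\Phi_{T,\pi}$ the spaces $\ker R_q(T)$ and $\ker R_q(T)^*$ are finite-dimensional, so that $\operatorname{ind}(R_q(T))$ is a well-defined integer, and the map $q\mapsto \operatorname{ind}(R_q(T))$ is constant on each connected component of $\Phi_{T,\pi}$. -/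

import Mathlib

open scoped Quaternion

/-- A right quaternionic inner product space: `V` is a module under right multiplication by
quaternions (`f q` is `MulOpposite.op q • f`), with an `ℍ`-valued inner product, conjugate-linear in
the first and right-linear in the second variable, whose norm is the norm of `V`.
The real vector space structure is the one obtained by restricting the right multiplication to the
reals (this is what `IsScalarTower ℝ ℍᵐᵒᵖ V` says). -/
class RightQuaternionicInnerProductSpace (V : Type*) [NormedAddCommGroup V]
    [Module ℍ[ℝ]ᵐᵒᵖ V] extends NormedSpace ℝ V, IsScalarTower ℝ ℍ[ℝ]ᵐᵒᵖ V, Inner ℍ[ℝ] V where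
  star_qinner : ∀ f g : V, star (inner f g) = inner g f
  qinner_self : ∀ f : V, inner f f = ((‖f‖ ^ 2 : ℝ) : ℍ[ℝ])
  qinner_add_right : ∀ f g h : V, inner f (g + h) = inner f g + inner f h
  qinner_smul_right : ∀ (f g : V) (q : ℍ[ℝ]), inner f (MulOpposite.op q • g) = inner f g * q

namespace RightQuaternionic

variable {V : Type*} [NormedAddCommGroup V] [Module ℍ[ℝ]ᵐᵒᵖ V]
  [RightQuaternionicInnerProductSpace V]

open RightQuaternionicInnerProductSpace

theorem qinner_add_left (f g h : V) : inner ℍ[ℝ] (f + g) h = inner ℍ[ℝ] f h + inner ℍ[ℝ] g h := by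
  rw [← star_qinner, qinner_add_right, star_add, star_qinner, star_qinner]

theorem qinner_smul_left (f g : V) (q : ℍ[ℝ]) :
    inner ℍ[ℝ] (MulOpposite.op q • f) g = star q * inner ℍ[ℝ] f g := by
  rw [← star_qinner, qinner_smul_right, star_mul, star_qinner]

theorem real_smul_eq (r : ℝ) (f : V) : r • f = MulOpposite.op (r : ℍ[ℝ]) • f := by
  have h : MulOpposite.op (r : ℍ[ℝ]) = r • (1 : ℍ[ℝ]ᵐᵒᵖ) := by
    apply MulOpposite.unop_injective
    ext <;> simp
  rw [h, smul_assoc, one_smul]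

variable (V) in
/-- The real inner product space underlying a right quaternionic inner product space, with inner
product the real part of `inner ℍ[ℝ] f g`. -/
noncomputable abbrev realInnerProductSpace : InnerProductSpace ℝ V where
  inner f g := (inner ℍ[ℝ] f g).re
  norm_sq_eq_re_inner f := by
    simp only [qinner_self, Quaternion.re_coe, RCLike.re_to_real]
  conj_inner_symm f g := by
    simp only [conj_trivial]
    rw [← star_qinner f g, Quaternion.re_star]
  add_left f g h := by rw [qinner_add_left, Quaternion.re_add]
  smul_left f g r := by
    rw [real_smul_eq, qinner_smul_left, Quaternion.star_coe, Quaternion.coe_mul_eq_smul]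
    simp

/-- A quaternion `a` is determined by the real parts of all the products `a q`. -/
theorem eq_of_re_mul_eq {a b : ℍ[ℝ]} (h : ∀ q : ℍ[ℝ], (a * q).re = (b * q).re) : a = b := by
  have h1 := h (star (a - b))
  rw [← sub_eq_zero, ← Quaternion.re_sub, ← sub_mul, Quaternion.self_mul_star,
    Quaternion.re_coe, Quaternion.normSq_eq_zero] at h1
  exact sub_eq_zero.mp h1

theorem ext_inner {x y : V} (h : ∀ z : V, inner ℍ[ℝ] x z = inner ℍ[ℝ] y z) : x = y := by
  let := realInnerProductSpace V
  refine ext_inner_right ℝ fun z => ?_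
  exact congrArg (fun q : ℍ[ℝ] => q.re) (h z)

/-- The bounded right linear operators `𝓑(V)`; a right linear map between normed spaces is bounded
exactly when it is continuous. The ring multiplication is composition. -/
abbrev BoundedOp (V : Type*) [NormedAddCommGroup V] [Module ℍ[ℝ]ᵐᵒᵖ V]
    [RightQuaternionicInnerProductSpace V] :=
  V →L[ℍ[ℝ]ᵐᵒᵖ] V

section Adjoint

variable [CompleteSpace V]

/-- The adjoint of the real linear operator underlying `T`, for the real inner product
`Re (inner f g)`. -/
noncomputable def realAdjoint (T : BoundedOp V) : V →L[ℝ] V :=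
  letI := realInnerProductSpace V
  ContinuousLinearMap.adjoint (T.restrictScalars ℝ)

theorem realAdjoint_inner (T : BoundedOp V) (f g : V) :
    inner ℍ[ℝ] (realAdjoint T f) g = inner ℍ[ℝ] f (T g) := by
  let := realInnerProductSpace V
  have key : ∀ u v : V, (inner ℍ[ℝ] (realAdjoint T u) v).re = (inner ℍ[ℝ] u (T v)).re := fun u v =>
    ContinuousLinearMap.adjoint_inner_left (T.restrictScalars ℝ) v u
  refine eq_of_re_mul_eq fun q => ?_
  rw [← qinner_smul_right, key, map_smul, qinner_smul_right]

/-- The adjoint `T*` of a bounded right linear operator, see `adjoint_inner`. -/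
noncomputable def adjoint (T : BoundedOp V) : BoundedOp V where
  toFun := realAdjoint T
  map_add' := map_add _
  map_smul' q f := by
    refine ext_inner fun z => ?_
    rw [← MulOpposite.op_unop q]
    simp only [RingHom.id_apply, realAdjoint_inner, qinner_smul_left]
  cont := (realAdjoint T).continuous

/-- The defining property of the adjoint. -/
theorem adjoint_inner (T : BoundedOp V) (f g : V) : inner ℍ[ℝ] (adjoint T f) g = inner ℍ[ℝ] f (T g) :=
  realAdjoint_inner T f g

/-- The index `dim ker A - dim ker A*`, the dimensions being those of right quaternionic vector
spaces. -/
noncomputable def ind (A : BoundedOp V) : ℤ :=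
  (Module.finrank ℍ[ℝ]ᵐᵒᵖ A.ker : ℤ) - (Module.finrank ℍ[ℝ]ᵐᵒᵖ (adjoint A).ker : ℤ)

end Adjoint

variable (V) in
/-- The two-sided ideal `𝓚(V)` of compact operators. -/
noncomputable def compactIdeal : TwoSidedIdeal (BoundedOp V) :=
  TwoSidedIdeal.mk' {K : BoundedOp V | IsCompactOperator K} isCompactOperator_zero
    (fun hx hy => hx.add hy) (fun hx => hx.neg) (fun {x} {_} hy => hy.clm_comp x)
    (fun {_} {y} hx => hx.comp_clm y)

theorem mem_compactIdeal (K : BoundedOp V) : K ∈ compactIdeal V ↔ IsCompactOperator K :=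
  TwoSidedIdeal.mem_mk' _ _ _ _ _ _ _

variable (V) in
/-- The Calkin algebra `𝓑(V) / 𝓚(V)`. -/
abbrev Calkin := (compactIdeal V).ringCon.Quotient

variable (V) in
/-- The quotient map from `𝓑(V)` to the Calkin algebra. -/
noncomputable def calkinMap : BoundedOp V →+* Calkin V := (compactIdeal V).ringCon.mk'

/-- The elements that are Fredholm relative to a ring homomorphism: those with invertible image. -/
def fredholmSet {R S : Type*} [Ring R] [Ring S] (φ : R →+* S) : Set R :=
  {v | IsUnit (φ v)}

/-- The operator `R_q(T) = T² - 2 Re(q) T + |q|² I`. -/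
noncomputable def Rq (q : ℍ[ℝ]) (T : BoundedOp V) : BoundedOp V :=
  T ^ 2 - (2 * q.re) • T + (‖q‖ ^ 2) • (1 : BoundedOp V)

/-- The set `Φ_{T,π}` of the quaternions `q` for which `R_q(T)` is Fredholm relative to the quotient
map onto the Calkin algebra. -/
def fredholmDomain (T : BoundedOp V) : Set ℍ[ℝ] :=
  {q | Rq q T ∈ fredholmSet (calkinMap V)}

end RightQuaternionic

/-! Forget the quaternions: under `Re ⟨f, g⟩`, `V` is a real Hilbert space. An inverse modulo
compacts gives a real Fredholm operator (Atkinson), whose cokernel is the kernel of the adjoint, so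
its real index is `4 * ind` (`index_restrictScalars`). The real index is locally constant on
Fredholm operators (`eventually_index_eq`), and `R_q(T)` is norm continuous in `q`. Hence `ind (Rq q
T)` is a continuous integer-valued function on `Φ`, constant on connected subsets. -/

open Topology LinearMap.FiniteRangeSetoid

/-! ### Atkinson's theorem on a real Hilbert space -/

section Fredholm

variable {E : Type*} [NormedAddCommGroup E] [InnerProductSpace ℝ E]

/-- A compact operator into a Hilbert space is approximated in norm by operators of finite rank. -/
theorem IsCompactOperator.exists_hasFiniteRange_norm_sub_le {K : E →L[ℝ] E}
    (hK : IsCompactOperator K) {ε : ℝ} (hε : 0 < ε) :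
    ∃ F : E →L[ℝ] E, F.toLinearMap.HasFiniteRange ∧ ‖K - F‖ ≤ ε := by
  have htb : TotallyBounded (K '' Metric.closedBall 0 1) :=
    (hK.isCompact_closure_image_closedBall 1).totallyBounded.subset subset_closure
  obtain ⟨t, ht, hcover⟩ := Metric.totallyBounded_iff.mp htb ε hε
  let S : Submodule ℝ E := Submodule.span ℝ t
  have : FiniteDimensional ℝ S := FiniteDimensional.span_of_finite ℝ ht
  -- Projecting onto the span of a finite `ε`-net gives a nearest point, so it moves `K x` by at
  -- most `ε`.
  refine ⟨S.starProjection ∘L K, ?_, ?_⟩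
  · have : Module.Finite ℝ (S.starProjection ∘L K).range :=
      Submodule.finiteDimensional_of_le (S₂ := S) <| by
        rintro _ ⟨x, rfl⟩
        exact S.starProjection_apply_mem _
    exact Submodule.FG.of_finite
  · refine ContinuousLinearMap.opNorm_le_of_unit_norm hε.le fun x hx => ?_
    obtain ⟨y, hy, hxy⟩ := Set.mem_iUnion₂.mp
      (hcover ⟨x, by simp [hx], rfl⟩)
    calc ‖(K - S.starProjection ∘L K) x‖ = ‖K x - S.starProjection (K x)‖ := rfl
      _ = ⨅ w : S, ‖K x - w‖ := S.starProjection_minimal _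
      _ ≤ ‖K x - y‖ := ciInf_le ⟨0, by rintro _ ⟨w, rfl⟩; positivity⟩
        (⟨y, Submodule.subset_span hy⟩ : S)
      _ ≤ ε := by rw [← dist_eq_norm]; exact (Metric.mem_ball.mp hxy).le

/-- Modulo operators of finite rank, an operator that differs from the identity by a compact
operator is invertible. -/
theorem exists_equiv_of_isCompactOperator_sub_one [CompleteSpace E] {A : E →L[ℝ] E}
    (hA : IsCompactOperator ⇑(A - 1)) :
    ∃ e : E ≃L[ℝ] E, A.toLinearMap ≈ (e : E →L[ℝ] E).toLinearMap := by
  obtain ⟨F, hF, hle⟩ := hA.exists_hasFiniteRange_norm_sub_le (ε := 1 / 2) (by norm_num)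
  -- `A - F` is within distance less than `1` of the identity, so a Neumann series inverts it.
  have hlt : ‖-(A - 1 - F)‖ < 1 := by rw [norm_neg]; linarith
  refine ⟨ContinuousLinearEquiv.ofUnit (Units.oneSub _ hlt), ?_⟩
  rw [equiv_iff_hasFiniteRange]
  convert! hF using 1
  ext x
  change A x - (1 - -(A - 1 - F)) x = F x
  simp
  abel

/-- An operator that is invertible modulo compact operators is Fredholm. -/
theorem ContinuousLinearMap.IsFredholm.of_isCompactOperator_sub_one [CompleteSpace E]
    {A B : E →L[ℝ] E} (hBA : IsCompactOperator ⇑(B * A - 1)) (hAB : IsCompactOperator ⇑(A * B - 1)) :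
    A.IsFredholm := by
  obtain ⟨e, he⟩ := exists_equiv_of_isCompactOperator_sub_one hBA
  obtain ⟨f, hf⟩ := exists_equiv_of_isCompactOperator_sub_one hAB
  set a := A.toLinearMap
  set b := B.toLinearMap
  let u : E →ₗ[ℝ] E := e.symm.toLinearMap ∘ₗ b
  let v : E →ₗ[ℝ] E := b ∘ₗ f.symm.toLinearMap
  have hu : u ∘ₗ a ≈ .id := by
    have h := equiv_comp_left (u' := e.symm.toLinearMap) he
    convert! h using 1
    ext x; simp
  have hv : a ∘ₗ v ≈ .id := by
    have h := equiv_comp_right (u := f.symm.toLinearMap) hf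
    convert! h using 1
    ext x; simp
  -- Left and right inverses modulo finite rank agree: `u ≈ u a v ≈ v`.
  have huv : u ≈ v := by
    have h1 : u ∘ₗ (a ∘ₗ v) ≈ u ∘ₗ .id := equiv_comp_left hv
    have h2 : (u ∘ₗ a) ∘ₗ v ≈ .id ∘ₗ v := equiv_comp_right hu
    exact Setoid.trans (Setoid.symm h1) h2
  exact .of_isQuasiInverse (v := (e.symm : E →L[ℝ] E) ∘L B)
    ⟨hu, Setoid.trans (equiv_comp_left huv) hv⟩

end Fredholm

/-! ### Stability of the index -/

section Index

variable {k M N : Type*} [Field k] [AddCommGroup M] [Module k M] [AddCommGroup N] [Module k N]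

/-- Linear maps which differ by a map of finite rank have the same index. -/
theorem LinearMap.index_eq_of_equiv {u v : M →ₗ[k] N} (h : u ≈ v)
    [FiniteDimensional k u.ker] [FiniteDimensional k (N ⧸ u.range)]
    [FiniteDimensional k v.ker] [FiniteDimensional k (N ⧸ v.range)] : u.index = v.index := by
  -- The maps agree on `S`, of finite codimension; additivity of the index lets the index of its
  -- inclusion cancel.
  let S := LinearMap.eqLocus u v
  have hS : FiniteDimensional k (M ⧸ S.subtype.range) := by
    rw [Submodule.range_subtype]
    exact equiv_iff_eqLocus_coFG.mp h
  have : FiniteDimensional k S.subtype.ker := by rw [Submodule.ker_subtype]; infer_instance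
  have h1 := LinearMap.index_comp (f := S.subtype) u
  have h2 := LinearMap.index_comp (f := S.subtype) v
  have h3 : u ∘ₗ S.subtype = v ∘ₗ S.subtype := by
    ext x
    exact x.2
  rw [h3] at h1
  linarith

end Index

namespace ContinuousLinearMap.IsFredholm

variable {E : Type*} [NormedAddCommGroup E] [NormedSpace ℝ E]

theorem finiteDimensional_quotient_range {A : E →L[ℝ] E} (hA : A.IsFredholm) :
    FiniteDimensional ℝ (E ⧸ A.range) :=
  hA.finite_coker

variable [CompleteSpace E]

/-- The index is constant near a Fredholm operator. -/
theorem eventually_index_eq {A : E →L[ℝ] E} (hA : A.IsFredholm) :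
    ∀ᶠ C in 𝓝 A, C.IsFredholm → C.toLinearMap.index = A.toLinearMap.index := by
  obtain ⟨B, hB⟩ := hA.exists_isQuasiInverse
  have hBF : B.IsFredholm := .of_isQuasiInverse hB.symm
  have key : ∀ᶠ C in 𝓝 A, C.IsFredholm → B.toLinearMap.index + C.toLinearMap.index = 0 := by
    -- Modulo finite rank, `B C = B A + B (C - A) ≈ 1 + B (C - A)`, which is invertible for `C` near
    -- `A`.
    have hcont : ContinuousAt (fun C : E →L[ℝ] E => 1 + B * (C - A)) A := by fun_prop
    have hunit : ∀ᶠ C in 𝓝 A, IsUnit (1 + B * (C - A)) :=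
      hcont.eventually (Units.isOpen.mem_nhds (by simp))
    filter_upwards [hunit] with C hC hCF
    obtain ⟨w, hw⟩ := hC
    let e := ContinuousLinearEquiv.ofUnit w
    have he : ∀ x, e x = x + B (C x - A x) := fun x => by
      change (w : E →L[ℝ] E) x = _
      rw [hw]
      simp
    have := hBF.finite_ker
    have := hCF.finite_ker
    have := hBF.finiteDimensional_quotient_range
    have := hCF.finiteDimensional_quotient_range
    have hequiv : B.toLinearMap ∘ₗ C.toLinearMap ≈ e.toLinearEquiv.toLinearMap := by
      have h := hB.1.equiv
      rw [equiv_iff_hasFiniteRange] at h ⊢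
      convert! h using 1
      ext x
      simp only [LinearMap.sub_apply, LinearMap.comp_apply, ContinuousLinearMap.coe_coe,
        LinearEquiv.coe_coe, ContinuousLinearEquiv.coe_toLinearEquiv, he, map_sub, LinearMap.id_apply]
      abel
    have : FiniteDimensional ℝ (B.toLinearMap ∘ₗ C.toLinearMap).ker := by
      rw [LinearMap.ker_comp]; infer_instance
    have : FiniteDimensional ℝ (E ⧸ (B.toLinearMap ∘ₗ C.toLinearMap).range) := by
      rw [LinearMap.range_comp]; infer_instance
    have : FiniteDimensional ℝ e.toLinearEquiv.toLinearMap.ker := by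
      rw [LinearEquiv.ker]; infer_instance
    have : FiniteDimensional ℝ (E ⧸ e.toLinearEquiv.toLinearMap.range) := by
      rw [LinearEquiv.range]; infer_instance
    rw [← LinearMap.index_comp, LinearMap.index_eq_of_equiv hequiv, LinearEquiv.index_eq_zero]
  filter_upwards [key] with C hC hCF
  have h1 := hC hCF
  -- The case `C = A` identifies the index of `A` as minus that of `B`.
  have h2 := key.self_of_nhds hA
  linarith

end ContinuousLinearMap.IsFredholm

namespace ContinuousLinearMap.IsFredholm

variable {E : Type*} [NormedAddCommGroup E] [InnerProductSpace ℝ E] [CompleteSpace E]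
  {A : E →L[ℝ] E}

/-- The cokernel of a Fredholm operator on a Hilbert space is the kernel of its adjoint. -/
theorem nonempty_quotient_range_equiv_ker_adjoint (hA : A.IsFredholm) :
    Nonempty ((E ⧸ A.range) ≃ₗ[ℝ] (ContinuousLinearMap.adjoint A).ker) := by
  have : CompleteSpace A.range := hA.isClosed_range.completeSpace_coe
  rw [← ContinuousLinearMap.orthogonal_range]
  exact ⟨Submodule.quotientEquivOfIsCompl _ _ (Submodule.isCompl_orthogonal _)⟩

theorem finiteDimensional_ker_adjoint (hA : A.IsFredholm) :
    FiniteDimensional ℝ (ContinuousLinearMap.adjoint A).ker := by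
  obtain ⟨e⟩ := hA.nonempty_quotient_range_equiv_ker_adjoint
  have := hA.finiteDimensional_quotient_range
  exact e.finiteDimensional

theorem index_eq_finrank_ker_sub_finrank_ker_adjoint (hA : A.IsFredholm) :
    A.toLinearMap.index = (Module.finrank ℝ A.ker : ℤ)
      - (Module.finrank ℝ (ContinuousLinearMap.adjoint A).ker : ℤ) := by
  obtain ⟨e⟩ := hA.nonempty_quotient_range_equiv_ker_adjoint
  rw [LinearMap.index_eq_finrank_sub, e.finrank_eq]

end ContinuousLinearMap.IsFredholm

/-! ### Descent from real to quaternionic operators -/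

namespace RightQuaternionic

variable {V : Type*} [NormedAddCommGroup V] [Module ℍ[ℝ]ᵐᵒᵖ V]
  [RightQuaternionicInnerProductSpace V]

theorem exists_isCompactOperator_sub_one {A : BoundedOp V} (hA : IsUnit (calkinMap V A)) :
    ∃ B : BoundedOp V, IsCompactOperator ⇑(B * A - 1) ∧ IsCompactOperator ⇑(A * B - 1) := by
  obtain ⟨b, hb1, hb2⟩ := isUnit_iff_exists.mp hA
  obtain ⟨B, rfl⟩ := (compactIdeal V).ringCon.mk'_surjective b
  have key : ∀ C : BoundedOp V, calkinMap V C = 1 → IsCompactOperator ⇑(C - 1) := by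
    intro C hC
    rw [← map_one (calkinMap V)] at hC
    rw [← mem_compactIdeal, ← TwoSidedIdeal.rel_iff]
    exact (compactIdeal V).ringCon.eq.mp hC
  exact ⟨B, key _ (by rw [map_mul]; exact hb2), key _ (by rw [map_mul]; exact hb1)⟩

theorem finrank_real_eq (S : Submodule ℍ[ℝ]ᵐᵒᵖ V) :
    Module.finrank ℝ S = 4 * Module.finrank ℍ[ℝ]ᵐᵒᵖ S := by
  have h : Module.finrank ℝ ℍ[ℝ]ᵐᵒᵖ = 4 := by
    rw [← (MulOpposite.opLinearEquiv ℝ (M := ℍ[ℝ])).finrank_eq, Quaternion.finrank_eq_four]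
  have := Module.finrank_mul_finrank ℝ ℍ[ℝ]ᵐᵒᵖ S
  rw [← this, h]

theorem continuous_restrictScalars_Rq (T : BoundedOp V) :
    Continuous fun q : ℍ[ℝ] => (Rq q T).restrictScalars ℝ := by
  have h : (fun q : ℍ[ℝ] => (Rq q T).restrictScalars ℝ) = fun q : ℍ[ℝ] =>
      (T.restrictScalars ℝ) ^ 2 - (2 * q.re) • T.restrictScalars ℝ
        + (‖q‖ ^ 2) • (1 : V →L[ℝ] V) := by
    ext q x
    simp [Rq, pow_two]
  rw [h]
  have := Quaternion.continuous_re
  fun_prop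

variable [CompleteSpace V]

theorem isFredholm_restrictScalars {A : BoundedOp V} (hA : IsUnit (calkinMap V A)) :
    (A.restrictScalars ℝ).IsFredholm := by
  let := realInnerProductSpace V
  obtain ⟨B, hBA, hAB⟩ := exists_isCompactOperator_sub_one hA
  exact .of_isCompactOperator_sub_one (B := B.restrictScalars ℝ) hBA hAB

theorem finite_ker {A : BoundedOp V} (hA : IsUnit (calkinMap V A)) :
    Module.Finite ℍ[ℝ]ᵐᵒᵖ A.ker := by
  have : Module.Finite ℝ A.ker := (isFredholm_restrictScalars hA).finite_ker
  exact .of_restrictScalars_finite ℝ _ _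

theorem finite_ker_adjoint {A : BoundedOp V} (hA : IsUnit (calkinMap V A)) :
    Module.Finite ℍ[ℝ]ᵐᵒᵖ (adjoint A).ker := by
  let := realInnerProductSpace V
  have : Module.Finite ℝ (adjoint A).ker :=
    (isFredholm_restrictScalars hA).finiteDimensional_ker_adjoint
  exact .of_restrictScalars_finite ℝ _ _

theorem index_restrictScalars {A : BoundedOp V} (hA : IsUnit (calkinMap V A)) :
    (A.restrictScalars ℝ).toLinearMap.index = 4 * ind A := by
  let := realInnerProductSpace V
  rw [(isFredholm_restrictScalars hA).index_eq_finrank_ker_sub_finrank_ker_adjoint, ind]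
  have h1 : Module.finrank ℝ (A.restrictScalars ℝ).ker = 4 * Module.finrank ℍ[ℝ]ᵐᵒᵖ A.ker :=
    finrank_real_eq A.ker
  have h2 : Module.finrank ℝ (ContinuousLinearMap.adjoint (A.restrictScalars ℝ)).ker
      = 4 * Module.finrank ℍ[ℝ]ᵐᵒᵖ (adjoint A).ker := finrank_real_eq (adjoint A).ker
  rw [h1, h2]
  push_cast
  ring

theorem continuousOn_ind_Rq (T : BoundedOp V) :
    ContinuousOn (fun q => ind (Rq q T)) (fredholmDomain T) := by
  intro p hp
  -- As `ℤ` is discrete, continuity means being locally constant.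
  rw [ContinuousWithinAt, nhds_discrete, Filter.tendsto_pure]
  have h := (continuous_restrictScalars_Rq T).continuousAt.eventually
    (isFredholm_restrictScalars hp).eventually_index_eq
  filter_upwards [nhdsWithin_le_nhds h, self_mem_nhdsWithin] with q hq hqΦ
  have h1 := hq (isFredholm_restrictScalars hqΦ)
  rw [index_restrictScalars hqΦ, index_restrictScalars hp] at h1
  linarith

end RightQuaternionic

theorem mainTheorem4 {V : Type*} [NormedAddCommGroup V] [Module ℍ[ℝ]ᵐᵒᵖ V]
    [RightQuaternionicInnerProductSpace V]
    [CompleteSpace V] [TopologicalSpace.SeparableSpace V] (T : RightQuaternionic.BoundedOp V) :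
    (∀ q ∈ RightQuaternionic.fredholmDomain T,
      Module.Finite ℍ[ℝ]ᵐᵒᵖ (RightQuaternionic.Rq q T).ker ∧
      Module.Finite ℍ[ℝ]ᵐᵒᵖ (RightQuaternionic.adjoint (RightQuaternionic.Rq q T)).ker) ∧
    ∀ p ∈ RightQuaternionic.fredholmDomain T,
      ∀ q ∈ connectedComponentIn (RightQuaternionic.fredholmDomain T) p,
        RightQuaternionic.ind (RightQuaternionic.Rq q T) =
          RightQuaternionic.ind (RightQuaternionic.Rq p T) := by
  refine ⟨fun q hq => ⟨RightQuaternionic.finite_ker hq, RightQuaternionic.finite_ker_adjoint hq⟩,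
    fun p hp q hq => ?_⟩
  exact isPreconnected_connectedComponentIn.constant
    ((RightQuaternionic.continuousOn_ind_Rq T).mono (connectedComponentIn_subset _ _)) hq
    (mem_connectedComponentIn hp)
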